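/- Throughout, $\lambda^n$ is Lebesgue measure on $\mathbb R^n$. Let $f:\mathbb R^n\to\mathbb R$ be locally Lipschitz continuous, let $N\subset\mathbb R^n$ satisfy $\lambda^n(N)=0$, and let $x\in\mathbb R^n$. Let $D_f$ be the set of points at which $f$ is differentiable, and let $Df(y)\in(\mathbb R^n)^*\cong\mathbb R^n$ be the derivative at $y\in D_f$; since $\lambda^n(\mathbb R^n\setminus D_f)=0$, put $Df:=0$ outside $D_f$. The Clarke generalized directional derivative and generalized gradient are $$f^\circ(x;v)=\limsup_{y\to x,\ t\downarrow 0}\frac{f(y+tv)-f(y)}{t},\qquad \partial f(x)=\{\varphi\in(\mathbb R^n)^* : \varphi(v)\le f^\circ(x;v)\ \text{for all } v\in\mathbb R^n\}.$$ A density measure at $x$ is a finitely additive set function $\mu:\mathcal B(\mathbb R^n)\to[0,\infty)$ on the Borel sets such that $\mu(A)=0$ whenever $\lambda^n(A)=0$, and $\mu(B_\delta(x))=\mu(\mathbb R^n)=1$ for all $\delta>0$; let $\mathrm{Dens}_x$ be the set of all of them. For such $\mu$ let $\mu^*(A)=\inf\{\mu(B): B\supset A\ \text{Borel}\}$. A function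 $g:\mathbb R^n\to\mathbb R$ is $\mu$-integrable with integral $\int g\,d\mu=a$ if there are simple Borel functions $s_k$ with $\mu^*(\{|s_k-g|>\varepsilon\})\to0$ for every $\varepsilon>0$, $\int|s_k-s_l|\,d\mu\to0$ as $k,l\to\infty$, and $\int s_k\,d\mu\to a$. Integrals of maps into $(\mathbb R^n)^*$ are taken componentwise. Then $$\partial f(x)=\operatorname{conv}\Big\{\lim_{k\to\infty}Df(x_k)\ :\ x_k\to x,\ x_k\in D_f\setminus N,\ \lim_{k\to\infty}Df(x_k)\text{ exists}\Big\}.$$ Moreover, for every $\mu\in\mathrm{Dens}_x$ the derivative $Df$ is $\mu$-integrable with a uniquely determined integral $\int Df\,d\mu\in(\mathbb R^n)^*$, and $$\partial f(x)=\langle \mathrm{Dens}_x,Df\rangle:=\Big\{\int Df\,d\mu\ :\ \mu\in\mathrm{Dens}_x\Big\}.$$ -/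

import Mathlib

open MeasureTheory Filter Topology Set

noncomputable section

/-- A real-valued finitely additive set function on the measurable subsets of `X`
(its values on non-measurable sets are irrelevant and never used below). -/
abbrev FinAddMeasure (X : Type*) [MeasurableSpace X] : Type _ :=
  AddContent ℝ {s : Set X | MeasurableSet s}

namespace FinAddMeasure

variable {X : Type*} [MeasurableSpace X]

/-- The outer measure of a positive finitely additive measure:
the infimum of `μ B` over all measurable `B` containing `A`. -/
def outer (μ : FinAddMeasure X) (A : Set X) : ℝ :=
  sInf {r : ℝ | ∃ B : Set X, MeasurableSet B ∧ A ⊆ B ∧ μ B = r}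

/-- Convergence in measure `s k → g` with respect to a positive finitely additive measure. -/
def TendstoInMeas (μ : FinAddMeasure X) (s : ℕ → X → ℝ) (g : X → ℝ) : Prop :=
  ∀ ε : ℝ, 0 < ε → Tendsto (fun k => outer μ {y | ε < |s k y - g y|}) atTop (𝓝 0)

/-- The integral `∑ r, r * μ {s = r}` of a simple function. -/
def simpleIntegral (μ : FinAddMeasure X) (s : SimpleFunc X ℝ) : ℝ :=
  ∑ r ∈ s.range, r * μ (s ⁻¹' {r})

/-- `HasIntegral μ g a`: the function `g` is integrable with respect to the positive finite
finitely additive measure `μ`, and its integral is `a`. That is, some sequence of simple functions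
converges to `g` in measure, is Cauchy in the `L¹`-seminorm, and has integrals tending to `a`. -/
def HasIntegral (μ : FinAddMeasure X) (g : X → ℝ) (a : ℝ) : Prop :=
  ∃ s : ℕ → SimpleFunc X ℝ,
    TendstoInMeas μ (fun k => s k) g ∧
    Tendsto (fun p : ℕ × ℕ => simpleIntegral μ ((s p.1 - s p.2).map (fun r => |r|)))
      atTop (𝓝 0) ∧
    Tendsto (fun k => simpleIntegral μ (s k)) atTop (𝓝 a)

/-- The integral of a covector field, taken componentwise: `w = ∫ F dμ` if, for every direction
`v`, the function `y ↦ F y v` is integrable with integral `w v`. -/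
def HasVectorIntegral {E : Type*} [NormedAddCommGroup E] [NormedSpace ℝ E]
    (μ : FinAddMeasure X) (F : X → (E →L[ℝ] ℝ)) (w : E →L[ℝ] ℝ) : Prop :=
  ∀ v : E, HasIntegral μ (fun y => F y v) (w v)

end FinAddMeasure

/-- `μ` is a density measure at the point `x` of `ℝⁿ`: a positive finitely additive measure on the
Borel sets that vanishes on Lebesgue-null sets, has total mass `1`, and gives the full mass `1` to
every ball around `x`. (Boundedness is automatic: `0 ≤ μ A ≤ μ univ = 1`.) -/
structure IsDensityMeasure {n : ℕ} (x : EuclideanSpace ℝ (Fin n))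
    (μ : FinAddMeasure (EuclideanSpace ℝ (Fin n))) : Prop where
  nonneg : ∀ A : Set (EuclideanSpace ℝ (Fin n)), MeasurableSet A → 0 ≤ μ A
  null : ∀ A : Set (EuclideanSpace ℝ (Fin n)), MeasurableSet A → volume A = 0 → μ A = 0
  total : μ univ = 1
  ball : ∀ δ : ℝ, 0 < δ → μ (Metric.ball x δ) = 1

section Clarke

variable {E : Type*} [NormedAddCommGroup E] [NormedSpace ℝ E]

/-- Clarke's generalized directional derivative: the limes superior of `(f (y + t v) - f y) / t`
as `y → x` and `t ↓ 0`. (The quotients are bounded near `(x, 0)` for locally Lipschitz `f`.) -/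
def clarkeDirDeriv (f : E → ℝ) (x v : E) : ℝ :=
  limsup (fun p : E × ℝ => (f (p.1 + p.2 • v) - f p.1) / p.2) (𝓝 x ×ˢ 𝓝[>] (0 : ℝ))

/-- Clarke's generalized gradient, a subset of the dual space. -/
def clarkeGradient (f : E → ℝ) (x : E) : Set (E →L[ℝ] ℝ) :=
  {φ | ∀ v : E, φ v ≤ clarkeDirDeriv f x v}

/-- All limits of `Df (u k)` along sequences `u k → x` of points of differentiability of `f`
outside `N`. -/
def limitingDerivs (f : E → ℝ) (N : Set E) (x : E) : Set (E →L[ℝ] ℝ) :=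
  {w | ∃ u : ℕ → E, Tendsto u atTop (𝓝 x) ∧
    (∀ k, DifferentiableAt ℝ f (u k) ∧ u k ∉ N) ∧
    Tendsto (fun k => fderiv ℝ f (u k)) atTop (𝓝 w)}

end Clarke

/-- The set of all integrals `∫ Df dμ`, where `μ` is a density measure at `x`. Here `Df` is
extended by `0` to the points of non-differentiability of `f`; for locally Lipschitz `f` these form
a Lebesgue-null set, which no density measure charges. -/
def densityIntegrals {n : ℕ} (f : EuclideanSpace ℝ (Fin n) → ℝ)
    (x : EuclideanSpace ℝ (Fin n)) : Set (EuclideanSpace ℝ (Fin n) →L[ℝ] ℝ) :=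
  {w | ∃ μ : FinAddMeasure (EuclideanSpace ℝ (Fin n)),
    IsDensityMeasure x μ ∧ FinAddMeasure.HasVectorIntegral μ (fderiv ℝ f) w}

end

/-! Everything is compared with one compact set `K = essLimitingDerivs`, the cluster points of `Df`
along the filter `𝓝 x ⊓ ae`. Such points survive the removal of any null set, so `K` lies in
`limitingDerivs f N x`. An ultrafilter finer than `𝓝 x ⊓ ae` is a two-valued density measure whose
integral is the limit along it, so `K` also lies in `densityIntegrals f x`. Both larger sets lie in
the convex set `∂f(x)`, and the density integrals are themselves convex.

It remains to show `∂f(x) ⊆ conv K` (`clarkeGradient_subset`). By Hahn–Banach separation this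
follows once the support function of `K` dominates `f°(x; ·)`. The analytic core is
`sub_le_of_ae_fderiv_le`: an almost everywhere bound on a directional derivative near `x` bounds all
nearby difference quotients. It is proved by averaging over small balls. -/

noncomputable section

namespace FinAddMeasure

variable {X : Type*} [MeasurableSpace X] {μ ν : FinAddMeasure X}

/-! ### Finitely additive measures and their outer measures -/

lemma union_eq {A B : Set X} (hA : MeasurableSet A) (hB : MeasurableSet B) (h : Disjoint A B) :
    μ (A ∪ B) = μ A + μ B :=
  addContent_union' hA hB (hA.union hB) h

/-- Positivity of a finitely additive measure. -/
def IsPos (μ : FinAddMeasure X) : Prop := ∀ A : Set X, MeasurableSet A → 0 ≤ μ A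

lemma IsPos.mono (hμ : IsPos μ) {A B : Set X} (hA : MeasurableSet A) (hB : MeasurableSet B)
    (h : A ⊆ B) : μ A ≤ μ B := by
  have := union_eq (μ := μ) hA (hB.diff hA) disjoint_sdiff_right
  rw [union_sdiff_cancel h] at this
  linarith [hμ _ (hB.diff hA)]

lemma IsPos.union_le (hμ : IsPos μ) {A B : Set X} (hA : MeasurableSet A) (hB : MeasurableSet B) :
    μ (A ∪ B) ≤ μ A + μ B := by
  have := union_eq (μ := μ) hA (hB.diff hA) disjoint_sdiff_right
  rw [union_sdiff_self] at this
  linarith [hμ.mono (hB.diff hA) hB sdiff_subset]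

lemma add_compl {A : Set X} (hA : MeasurableSet A) : μ A + μ Aᶜ = μ univ := by
  rw [← union_eq hA hA.compl disjoint_compl_right, union_compl_self]

lemma IsPos.outer_bddBelow (hμ : IsPos μ) (A : Set X) :
    BddBelow {r : ℝ | ∃ B : Set X, MeasurableSet B ∧ A ⊆ B ∧ μ B = r} :=
  ⟨0, by rintro r ⟨B, hB, -, rfl⟩; exact hμ B hB⟩

lemma outer_set_nonempty (μ : FinAddMeasure X) (A : Set X) :
    {r : ℝ | ∃ B : Set X, MeasurableSet B ∧ A ⊆ B ∧ μ B = r}.Nonempty :=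
  ⟨_, univ, .univ, subset_univ _, rfl⟩

lemma IsPos.outer_nonneg (hμ : IsPos μ) (A : Set X) : 0 ≤ outer μ A :=
  Real.sInf_nonneg (by rintro r ⟨B, hB, -, rfl⟩; exact hμ B hB)

lemma IsPos.outer_le (hμ : IsPos μ) {A B : Set X} (hB : MeasurableSet B) (h : A ⊆ B) :
    outer μ A ≤ μ B :=
  csInf_le (hμ.outer_bddBelow A) ⟨B, hB, h, rfl⟩

lemma IsPos.le_outer (hμ : IsPos μ) {A B : Set X} (hA : MeasurableSet A) (h : A ⊆ B) :
    μ A ≤ outer μ B :=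
  le_csInf (outer_set_nonempty μ B) (by rintro r ⟨C, hC, hBC, rfl⟩; exact hμ.mono hA hC (h.trans hBC))

lemma IsPos.outer_mono (hμ : IsPos μ) {A B : Set X} (h : A ⊆ B) : outer μ A ≤ outer μ B :=
  le_csInf (outer_set_nonempty μ B) (by rintro r ⟨C, hC, hBC, rfl⟩; exact hμ.outer_le hC (h.trans hBC))

lemma IsPos.outer_union_le (hμ : IsPos μ) (A B : Set X) :
    outer μ (A ∪ B) ≤ outer μ A + outer μ B := by
  refine le_of_forall_pos_le_add fun ε hε => ?_
  obtain ⟨_, ⟨C, hC, hAC, rfl⟩, h1⟩ :=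
    exists_lt_of_csInf_lt (outer_set_nonempty μ A) (lt_add_of_pos_right (outer μ A) (half_pos hε))
  obtain ⟨_, ⟨D, hD, hBD, rfl⟩, h2⟩ :=
    exists_lt_of_csInf_lt (outer_set_nonempty μ B) (lt_add_of_pos_right (outer μ B) (half_pos hε))
  linarith [hμ.outer_le (hC.union hD) (union_subset_union hAC hBD), hμ.union_le hC hD]

/-! ### Integrals of simple functions -/

/-- The operator-valued set function underlying `simpleIntegral`. -/
def toOp (μ : FinAddMeasure X) (A : Set X) : ℝ →L[ℝ] ℝ := μ A • ContinuousLinearMap.id ℝ ℝ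

/-- With reference measure `0` every set has finite measure and every function is integrable. The
calculus of `setToSimpleFunc`, which needs only finite additivity, then applies without side
conditions. -/
lemma toOp_additive (μ : FinAddMeasure X) : FinMeasAdditive (0 : Measure X) (toOp μ) := by
  intro A B hA hB _ _ hAB
  simp [toOp, union_eq hA hB hAB, add_smul]

lemma simpleIntegral_eq (s : SimpleFunc X ℝ) : simpleIntegral μ s = s.setToSimpleFunc (toOp μ) := by
  simp [simpleIntegral, SimpleFunc.setToSimpleFunc, toOp, mul_comm]

lemma integrable_zero_measure (s : SimpleFunc X ℝ) : Integrable s (0 : Measure X) :=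
  MeasureTheory.integrable_zero_measure

lemma simpleIntegral_add (s t : SimpleFunc X ℝ) :
    simpleIntegral μ (s + t) = simpleIntegral μ s + simpleIntegral μ t := by
  simp only [simpleIntegral_eq]
  exact SimpleFunc.setToSimpleFunc_add _ (toOp_additive μ) (integrable_zero_measure s)
    (integrable_zero_measure t)

lemma simpleIntegral_sub (s t : SimpleFunc X ℝ) :
    simpleIntegral μ (s - t) = simpleIntegral μ s - simpleIntegral μ t := by
  simp only [simpleIntegral_eq]
  exact SimpleFunc.setToSimpleFunc_sub _ (toOp_additive μ) (integrable_zero_measure s)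
    (integrable_zero_measure t)

lemma simpleIntegral_smul (c : ℝ) (s : SimpleFunc X ℝ) :
    simpleIntegral μ (c • s) = c * simpleIntegral μ s := by
  simp only [simpleIntegral_eq]
  exact SimpleFunc.setToSimpleFunc_smul_real _ (toOp_additive μ) c (integrable_zero_measure s)

lemma simpleIntegral_const (c : ℝ) :
    simpleIntegral μ (SimpleFunc.const X c) = c * μ univ := by
  rw [simpleIntegral_eq, SimpleFunc.setToSimpleFunc_const _ (by simp [toOp])]
  simp [toOp, mul_comm]

lemma simpleIntegral_indicator {A : Set X} (hA : MeasurableSet A) (c : ℝ) :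
    simpleIntegral μ (SimpleFunc.piecewise A hA (SimpleFunc.const X c) (SimpleFunc.const X 0)) =
      c * μ A := by
  rw [simpleIntegral_eq]
  refine (SimpleFunc.setToSimpleFunc_indicator _ (by simp [toOp]) hA c).trans ?_
  simp [toOp, mul_comm]

lemma IsPos.simpleIntegral_nonneg (hμ : IsPos μ) {s : SimpleFunc X ℝ} (h : ∀ y, 0 ≤ s y) :
    0 ≤ simpleIntegral μ s := by
  refine Finset.sum_nonneg fun r hr => ?_
  obtain ⟨y, rfl⟩ := SimpleFunc.mem_range.1 hr
  exact mul_nonneg (h y) (hμ _ (s.measurableSet_fiber _))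

lemma IsPos.simpleIntegral_mono (hμ : IsPos μ) {s t : SimpleFunc X ℝ} (h : ∀ y, s y ≤ t y) :
    simpleIntegral μ s ≤ simpleIntegral μ t := by
  have := hμ.simpleIntegral_nonneg (s := t - s) fun y => by simpa using h y
  rw [simpleIntegral_sub] at this
  linarith

lemma IsPos.abs_simpleIntegral_le (hμ : IsPos μ) (s : SimpleFunc X ℝ) :
    |simpleIntegral μ s| ≤ simpleIntegral μ (s.map fun r => |r|) := by
  refine abs_le.2 ⟨?_, hμ.simpleIntegral_mono fun y => by simpa using le_abs_self _⟩
  have := hμ.simpleIntegral_mono (s := (-1 : ℝ) • s) (t := s.map fun r => |r|)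
    fun y => by simpa using neg_le_abs _
  rw [simpleIntegral_smul] at this
  linarith

lemma IsPos.simpleIntegral_le_of_le_on (hμ : IsPos μ) {S : Set X}
    (hS : MeasurableSet S) (hS0 : μ Sᶜ = 0) {s : SimpleFunc X ℝ} {c : ℝ} (h : ∀ y ∈ S, s y ≤ c) :
    simpleIntegral μ s ≤ c * μ univ := by
  obtain ⟨M, hM⟩ := s.exists_forall_norm_le
  -- The correction `M - c` lives on `Sᶜ` and is weighted by `μ Sᶜ = 0`.
  have := hμ.simpleIntegral_mono (s := s) (t := SimpleFunc.const X c +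
    SimpleFunc.piecewise Sᶜ hS.compl (SimpleFunc.const X (M - c)) (SimpleFunc.const X 0)) fun y => by
      by_cases hy : y ∈ S
      · simpa [hy] using h y hy
      · simpa [hy] using (le_abs_self _).trans (hM y)
  rwa [simpleIntegral_add, simpleIntegral_indicator, hS0, simpleIntegral_const, mul_zero,
    add_zero] at this

/-! ### The integral -/

lemma IsPos.tendstoInMeas_add (hμ : IsPos μ) {s t : ℕ → X → ℝ} {g h : X → ℝ}
    (hs : TendstoInMeas μ s g) (ht : TendstoInMeas μ t h) :
    TendstoInMeas μ (fun k => s k + t k) (g + h) := by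
  intro ε hε
  have := (hs (ε / 2) (half_pos hε)).add (ht (ε / 2) (half_pos hε))
  rw [add_zero] at this
  refine squeeze_zero (fun k => hμ.outer_nonneg _) (fun k => ?_) this
  refine (hμ.outer_mono fun y hy => ?_).trans (hμ.outer_union_le _ _)
  simp only [mem_ofPred_eq, Pi.add_apply, mem_union] at hy ⊢
  by_contra! hcon
  have := abs_add_le (s k y - g y) (t k y - h y)
  rw [show s k y - g y + (t k y - h y) = s k y + t k y - (g y + h y) by ring] at this
  linarith

lemma IsPos.tendstoInMeas_smul (hμ : IsPos μ) {s : ℕ → X → ℝ} {g : X → ℝ} (c : ℝ)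
    (hs : TendstoInMeas μ s g) : TendstoInMeas μ (fun k => c • s k) (c • g) := by
  intro ε hε
  refine squeeze_zero (fun k => hμ.outer_nonneg _) (fun k => ?_) (hs (ε / (|c| + 1)) (by positivity))
  refine hμ.outer_mono fun y hy => ?_
  simp only [mem_ofPred_eq, Pi.smul_apply, smul_eq_mul] at hy ⊢
  rw [← mul_sub, abs_mul] at hy
  rw [div_lt_iff₀ (by positivity)]
  nlinarith [abs_nonneg (s k y - g y)]

lemma IsPos.hasIntegral_add (hμ : IsPos μ) {g h : X → ℝ} {a b : ℝ}
    (hg : HasIntegral μ g a) (hh : HasIntegral μ h b) : HasIntegral μ (g + h) (a + b) := by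
  obtain ⟨s, hs1, hs2, hs3⟩ := hg
  obtain ⟨t, ht1, ht2, ht3⟩ := hh
  refine ⟨fun k => s k + t k, hμ.tendstoInMeas_add hs1 ht1, ?_, ?_⟩
  · have := hs2.add ht2
    rw [add_zero] at this
    refine squeeze_zero (fun p => hμ.simpleIntegral_nonneg fun y => by simp) (fun p => ?_) this
    rw [← simpleIntegral_add]
    refine hμ.simpleIntegral_mono fun y => ?_
    simp only [SimpleFunc.coe_map, SimpleFunc.coe_sub, SimpleFunc.coe_add, Function.comp_apply,
      Pi.sub_apply, Pi.add_apply]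
    rw [add_sub_add_comm]
    exact abs_add_le _ _
  · simpa only [simpleIntegral_add] using hs3.add ht3

lemma IsPos.hasIntegral_smul (hμ : IsPos μ) {g : X → ℝ} {a : ℝ} (c : ℝ)
    (hg : HasIntegral μ g a) : HasIntegral μ (c • g) (c * a) := by
  obtain ⟨s, hs1, hs2, hs3⟩ := hg
  refine ⟨fun k => c • s k, hμ.tendstoInMeas_smul c hs1, ?_, ?_⟩
  · have := hs2.const_mul |c|
    rw [mul_zero] at this
    refine this.congr fun p => ?_
    rw [← simpleIntegral_smul]
    congr 1
    ext y
    simp [← mul_sub, abs_mul]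
  · simpa only [simpleIntegral_smul] using hs3.const_mul c

/-- Monotonicity of the integral: a bound on a set of full measure bounds the integral. -/
lemma IsPos.le_of_hasIntegral (hμ : IsPos μ) (h1 : μ univ = 1) {g : X → ℝ} {a c : ℝ}
    (hg : HasIntegral μ g a) {S : Set X} (hS : MeasurableSet S) (hS0 : μ Sᶜ = 0)
    (hc : ∀ y ∈ S, g y ≤ c) : a ≤ c := by
  obtain ⟨s, hs1, hs2, hs3⟩ := hg
  refine le_of_forall_pos_le_add fun ε hε => ?_
  have hε2 : 0 < ε / 2 := half_pos hε
  obtain ⟨⟨K, K'⟩, hK⟩ := eventually_atTop.1 (hs2.eventually_lt_const hε2)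
  set m := max K K'
  obtain ⟨M, hM⟩ := (s m).exists_forall_norm_le
  have hA : ∀ k, MeasurableSet {y | c + ε / 2 < s k y} := fun k =>
    measurableSet_lt measurable_const (s k).measurable
  have hA0 : Tendsto (fun k => μ {y | c + ε / 2 < s k y}) atTop (𝓝 0) := by
    refine squeeze_zero (fun k => hμ _ (hA k)) (fun k => ?_) (hs1 (ε / 2) hε2)
    have hsub : {y | c + ε / 2 < s k y} ⊆ {y | ε / 2 < |s k y - g y|} ∪ Sᶜ := by
      intro y hy
      by_cases hyS : y ∈ S
      · left
        have hy' : c + ε / 2 < s k y := hy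
        have hlt : ε / 2 < s k y - g y := by linarith [hc y hyS]
        exact hlt.trans_le (le_abs_self _)
      · exact Or.inr hyS
    have h2 := (hμ.le_outer (hA k) hsub).trans (hμ.outer_union_le _ _)
    linarith [hμ.outer_le hS.compl subset_rfl]
  -- On the bad set, `s k ≤ |s k - s m| + M` with `m` fixed: the Cauchy property controls the first
  -- term, and the constant `M` is multiplied by a mass tending to `0`.
  have hle : ∀ᶠ k in atTop, simpleIntegral μ (s k) ≤
      (c + ε / 2) + ε / 2 + (M + |c + ε / 2|) * μ {y | c + ε / 2 < s k y} := by
    filter_upwards [eventually_ge_atTop m] with k hk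
    have h3 := hK (k, m) ⟨(le_max_left _ _).trans hk, le_max_right _ _⟩
    have h4 := hμ.simpleIntegral_mono (s := s k) (t := SimpleFunc.const X (c + ε / 2) +
      (s k - s m).map (fun r => |r|) + SimpleFunc.piecewise _ (hA k)
        (SimpleFunc.const X (M + |c + ε / 2|)) (SimpleFunc.const X 0)) fun y => by
        have h5 := (le_abs_self _).trans (hM y)
        have h6 := neg_abs_le (c + ε / 2)
        have h7 := le_abs_self (s k y - s m y)
        have h8 := abs_nonneg (s k y - s m y)
        by_cases hy : c + ε / 2 < s k y
        · simp [hy]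
          linarith
        · simp [hy]
          linarith
    rw [simpleIntegral_add, simpleIntegral_add, simpleIntegral_indicator, simpleIntegral_const,
      h1] at h4
    linarith
  have := le_of_tendsto_of_tendsto hs3 ((hA0.const_mul _).const_add _) hle
  linarith

/-- The number `a - b` is an integral of `g - g = 0`, hence at most `0`; then exchange `a` and `b`.
-/
lemma IsPos.hasIntegral_unique (hμ : IsPos μ) (h1 : μ univ = 1) {g : X → ℝ} {a b : ℝ}
    (ha : HasIntegral μ g a) (hb : HasIntegral μ g b) : a = b := by
  have key : ∀ a b, HasIntegral μ g a → HasIntegral μ g b → a ≤ b := by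
    intro a b ha hb
    have := hμ.le_of_hasIntegral h1 (hμ.hasIntegral_add ha (hμ.hasIntegral_smul (-1) hb)) .univ
      (by simp) (c := 0) (by simp)
    linarith
  exact le_antisymm (key a b ha hb) (key b a hb ha)

/-- Uniform approximation of a bounded measurable function by simple functions. -/
lemma exists_simpleFunc_approx {g : X → ℝ} (hg : Measurable g) {S : Set X} (hS : MeasurableSet S)
    {M : ℝ} (hM : ∀ y ∈ S, |g y| ≤ M) :
    ∃ s : ℕ → SimpleFunc X ℝ, ∀ k, ∀ y ∈ S, |s k y - g y| ≤ 1 / ((k : ℝ) + 1) := by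
  have hb : ∀ y, |S.indicator g y| ≤ |M| := by
    intro y
    by_cases hy : y ∈ S
    · simpa [hy] using (hM y hy).trans (le_abs_self M)
    · simp [hy]
  have hmeas : ∀ k : ℕ, Measurable fun y => (⌊((k : ℝ) + 1) * S.indicator g y⌋ : ℤ) := fun k =>
    ((hg.indicator hS).const_mul _).floor
  -- Values are rounded down to the grid of mesh `1 / (k + 1)`; cutting `g` off outside `S` makes it
  -- bounded, so only finitely many grid points occur.
  refine ⟨fun k => (⟨fun y => ((⌊((k : ℝ) + 1) * S.indicator g y⌋ : ℤ) : ℝ) / (k + 1),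
    fun r => ((measurable_from_top.comp (hmeas k)).div_const _) (measurableSet_singleton r), ?_⟩),
    fun k y hy => ?_⟩
  · refine ((finite_Icc (⌊-(((k : ℝ) + 1) * |M|)⌋) (⌊((k : ℝ) + 1) * |M|⌋)).image
      (fun z : ℤ => (z : ℝ) / (k + 1))).subset ?_
    rintro _ ⟨y, rfl⟩
    have h := abs_le.1 (hb y)
    have hk : (0 : ℝ) ≤ (k : ℝ) + 1 := by positivity
    refine ⟨_, ⟨Int.floor_le_floor ?_, Int.floor_le_floor ?_⟩, rfl⟩
    · rw [← mul_neg]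
      exact mul_le_mul_of_nonneg_left h.1 hk
    · exact mul_le_mul_of_nonneg_left h.2 hk
  · have hk : (0 : ℝ) < (k : ℝ) + 1 := by positivity
    simp only [SimpleFunc.coe_mk, indicator_of_mem hy]
    have h1 := Int.floor_le (((k : ℝ) + 1) * g y)
    have h2 := Int.lt_floor_add_one (((k : ℝ) + 1) * g y)
    rw [div_sub' hk.ne', abs_div, abs_of_pos hk]
    gcongr
    rw [abs_le]
    constructor <;> linarith

/-- The sequence `s` is an input that does not depend on `μ`, so that one sequence can serve several
measures in `hasIntegral_combo`. -/
lemma IsPos.exists_hasIntegral_of_approx (hμ : IsPos μ) (h1 : μ univ = 1) {g : X → ℝ} {S : Set X}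
    (hS : MeasurableSet S) (hS0 : μ Sᶜ = 0) {s : ℕ → SimpleFunc X ℝ}
    (hs : ∀ k, ∀ y ∈ S, |s k y - g y| ≤ 1 / ((k : ℝ) + 1)) :
    TendstoInMeas μ (fun k => s k) g ∧
    Tendsto (fun p : ℕ × ℕ => simpleIntegral μ ((s p.1 - s p.2).map (fun r => |r|))) atTop (𝓝 0) ∧
    ∃ a, Tendsto (fun k => simpleIntegral μ (s k)) atTop (𝓝 a) := by
  have hlim := tendsto_one_div_add_atTop_nhds_zero_nat (𝕜 := ℝ)
  have hC : Tendsto (fun p : ℕ × ℕ => simpleIntegral μ ((s p.1 - s p.2).map (fun r => |r|)))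
      atTop (𝓝 0) := by
    have h2 : Tendsto (fun p : ℕ × ℕ => 1 / ((p.1 : ℝ) + 1) + 1 / ((p.2 : ℝ) + 1)) atTop (𝓝 0) := by
      rw [← prod_atTop_atTop_eq, ← add_zero (0 : ℝ)]
      exact (hlim.comp tendsto_fst).add (hlim.comp tendsto_snd)
    refine squeeze_zero (fun p => hμ.simpleIntegral_nonneg fun y => by simp) (fun p => ?_) h2
    have := hμ.simpleIntegral_le_of_le_on hS hS0 (s := (s p.1 - s p.2).map (fun r => |r|))
      (c := 1 / ((p.1 : ℝ) + 1) + 1 / ((p.2 : ℝ) + 1)) fun y hy => by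
        have h3 := hs p.1 y hy
        have h4 := hs p.2 y hy
        rw [abs_sub_comm] at h4
        simpa using (abs_sub_le (s p.1 y) (g y) (s p.2 y)).trans (add_le_add h3 h4)
    rwa [h1, mul_one] at this
  refine ⟨fun ε hε => ?_, hC, ?_⟩
  · refine tendsto_const_nhds.congr' ?_
    filter_upwards [hlim.eventually_lt_const hε] with k hk
    refine le_antisymm (hμ.outer_nonneg _) (hS0 ▸ hμ.outer_le hS.compl fun y hy hyS => ?_)
    exact absurd (hs k y hyS) (not_le.2 (hk.trans hy))
  · refine cauchySeq_tendsto_of_complete (cauchySeq_iff_tendsto_dist_atTop_0.2 ?_)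
    refine squeeze_zero (fun p => dist_nonneg) (fun p => ?_) hC
    rw [Real.dist_eq, ← simpleIntegral_sub]
    exact hμ.abs_simpleIntegral_le _

lemma IsPos.exists_hasIntegral (hμ : IsPos μ) (h1 : μ univ = 1) {g : X → ℝ} (hg : Measurable g)
    {S : Set X} (hS : MeasurableSet S) (hS0 : μ Sᶜ = 0) {M : ℝ} (hM : ∀ y ∈ S, |g y| ≤ M) :
    ∃ a, HasIntegral μ g a := by
  obtain ⟨s, hs⟩ := exists_simpleFunc_approx hg hS hM
  obtain ⟨h2, h3, a, h4⟩ := hμ.exists_hasIntegral_of_approx h1 hS hS0 hs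
  exact ⟨a, s, h2, h3, h4⟩

/-! ### Linear combinations and point masses of ultrafilters -/

/-- The linear combination `a μ + b ν`. -/
def combo (a b : ℝ) (μ ν : FinAddMeasure X) : FinAddMeasure X where
  toFun A := a * μ A + b * ν A
  empty' := by simp
  sUnion' I h h' h'' := by
    simp only [addContent_sUnion h h' h'', Finset.mul_sum, Finset.sum_add_distrib]

lemma combo_apply (a b : ℝ) (A : Set X) : combo a b μ ν A = a * μ A + b * ν A := rfl

lemma simpleIntegral_combo (a b : ℝ) (s : SimpleFunc X ℝ) :
    simpleIntegral (combo a b μ ν) s = a * simpleIntegral μ s + b * simpleIntegral ν s := by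
  simp only [simpleIntegral, combo_apply, Finset.mul_sum, ← Finset.sum_add_distrib]
  exact Finset.sum_congr rfl fun r _ => by ring

lemma IsPos.combo (hμ : IsPos μ) (hν : IsPos ν) {a b : ℝ} (ha : 0 ≤ a) (hb : 0 ≤ b) :
    IsPos (combo a b μ ν) := fun A hA =>
  add_nonneg (mul_nonneg ha (hμ A hA)) (mul_nonneg hb (hν A hA))

/-- The given integrals may come from different approximating sequences. Uniqueness allows both to
be recomputed along one common sequence, on which the integral is linear in the measure. -/
lemma IsPos.hasIntegral_combo (hμ : IsPos μ) (hν : IsPos ν) (hμ1 : μ univ = 1) (hν1 : ν univ = 1)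
    {a b : ℝ} (ha : 0 ≤ a) (hb : 0 ≤ b) (hab : a + b = 1) {g : X → ℝ} (hg : Measurable g)
    {S : Set X} (hS : MeasurableSet S) (hμS : μ Sᶜ = 0) (hνS : ν Sᶜ = 0) {M : ℝ}
    (hM : ∀ y ∈ S, |g y| ≤ M) {p q : ℝ} (hp : HasIntegral μ g p) (hq : HasIntegral ν g q) :
    HasIntegral (FinAddMeasure.combo a b μ ν) g (a * p + b * q) := by
  obtain ⟨s, hs⟩ := exists_simpleFunc_approx hg hS hM
  obtain ⟨h2, h3, p', h4⟩ := hμ.exists_hasIntegral_of_approx hμ1 hS hμS hs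
  obtain ⟨k2, k3, q', k4⟩ := hν.exists_hasIntegral_of_approx hν1 hS hνS hs
  obtain rfl := hμ.hasIntegral_unique hμ1 hp ⟨s, h2, h3, h4⟩
  obtain rfl := hν.hasIntegral_unique hν1 hq ⟨s, k2, k3, k4⟩
  obtain ⟨l2, l3, -⟩ := (hμ.combo hν ha hb).exists_hasIntegral_of_approx
    (by simp [combo_apply, hμ1, hν1, hab]) hS (by simp [combo_apply, hμS, hνS]) hs
  refine ⟨s, l2, l3, ?_⟩
  simpa only [simpleIntegral_combo] using (h4.const_mul a).add (k4.const_mul b)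

open Classical in
/-- The two-valued finitely additive measure of an ultrafilter. -/
def ofUltrafilter (U : Ultrafilter X) : FinAddMeasure X where
  toFun A := if A ∈ U then 1 else 0
  empty' := by simp
  sUnion' I _ hdis _ := by
    by_cases h : ⋃₀ (I : Set (Set X)) ∈ U
    · obtain ⟨A, hA, hAU⟩ := (Ultrafilter.finite_sUnion_mem_iff I.finite_toSet).1 h
      rw [if_pos h, Finset.sum_eq_single_of_mem A hA, if_pos hAU]
      intro B hB hBA
      rw [if_neg]
      intro hBU
      exact U.empty_notMem ((hdis hB hA hBA).inter_eq ▸ inter_mem hBU hAU)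
    · rw [if_neg h, Finset.sum_eq_zero]
      intro A hA
      rw [if_neg]
      exact fun hAU => h (mem_of_superset hAU (subset_sUnion_of_mem hA))

lemma ofUltrafilter_of_mem {U : Ultrafilter X} {A : Set X} (h : A ∈ U) : ofUltrafilter U A = 1 :=
  if_pos h

lemma ofUltrafilter_of_notMem {U : Ultrafilter X} {A : Set X} (h : A ∉ U) :
    ofUltrafilter U A = 0 :=
  if_neg h

lemma isPos_ofUltrafilter (U : Ultrafilter X) : IsPos (ofUltrafilter U) := fun A _ => by
  by_cases h : A ∈ U
  · simp [ofUltrafilter_of_mem h]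
  · simp [ofUltrafilter_of_notMem h]

/-- The integral with respect to an ultrafilter is the limit along it. -/
lemma hasIntegral_ofUltrafilter {U : Ultrafilter X} {g : X → ℝ} (hg : Measurable g) {a : ℝ}
    (h : Tendsto g U (𝓝 a)) : HasIntegral (ofUltrafilter U) g a := by
  have hpos := isPos_ofUltrafilter U
  have h1 : ofUltrafilter U univ = 1 := ofUltrafilter_of_mem univ_mem
  -- These sets belong to `U`, so they have full mass: `ε = 1` gives integrability, and arbitrary
  -- `ε` pins the integral to `a`.
  have hball : ∀ ε > 0, MeasurableSet {y | |g y - a| ≤ ε} ∧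
      ofUltrafilter U {y | |g y - a| ≤ ε}ᶜ = 0 := by
    refine fun ε hε => ⟨measurableSet_le (by fun_prop) measurable_const,
      ofUltrafilter_of_notMem (Ultrafilter.compl_notMem_iff.2 ?_)⟩
    filter_upwards [h (Metric.closedBall_mem_nhds a hε)] with y hy
    simpa [Real.dist_eq] using hy
  obtain ⟨b, hb⟩ := hpos.exists_hasIntegral h1 hg (hball 1 one_pos).1 (hball 1 one_pos).2
    (M := |a| + 1) fun y hy => by
      have : |g y - a| ≤ 1 := hy
      linarith [abs_sub_abs_le_abs_sub (g y) a]
  have hle : b ≤ a := le_of_forall_pos_le_add fun ε hε =>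
    hpos.le_of_hasIntegral h1 hb (hball ε hε).1 (hball ε hε).2 fun y hy => by
      have := abs_le.1 (show |g y - a| ≤ ε from hy)
      linarith
  have hge : a ≤ b := le_of_forall_pos_le_add fun ε hε => by
    have := hpos.le_of_hasIntegral h1 (hpos.hasIntegral_smul (-1) hb) (hball ε hε).1 (hball ε hε).2
      (c := -a + ε) fun y hy => by
        have := abs_le.1 (show |g y - a| ≤ ε from hy)
        simp only [Pi.smul_apply, smul_eq_mul]
        linarith
    linarith
  rwa [← le_antisymm hle hge]

end FinAddMeasure

/-! ### Convex hulls of compact sets -/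

/-- In a finite-dimensional space the convex hull of a compact set is compact. -/
lemma IsCompact.isCompact_convexHull {V : Type*} [NormedAddCommGroup V] [NormedSpace ℝ V]
    [FiniteDimensional ℝ V] {K : Set V} (hK : IsCompact K) : IsCompact (convexHull ℝ K) := by
  -- By Carathéodory, `dim V + 1` points suffice, so the hull is a continuous image of a simplex
  -- times a power of `K`.
  set ι := Fin (Module.finrank ℝ V + 1)
  have hcomp : IsCompact ((fun p : (ι → ℝ) × (ι → V) => ∑ i, p.1 i • p.2 i) ''
      (stdSimplex ℝ ι ×ˢ univ.pi fun _ => K)) :=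
    ((isCompact_stdSimplex ℝ ι).prod (isCompact_univ_pi fun _ => hK)).image (by fun_prop)
  convert hcomp using 1
  refine subset_antisymm (fun y hy => ?_) ?_
  · rw [convexHull_eq_union] at hy
    simp only [mem_iUnion, exists_prop] at hy
    obtain ⟨t, htK, hind, hyt⟩ := hy
    obtain ⟨w, hw0, hw1, rfl⟩ := Finset.mem_convexHull'.1 hyt
    have hcard : Fintype.card t ≤ Fintype.card ι := by
      simpa [ι] using hind.card_le_finrank_succ.trans
        (Nat.succ_le_succ (Submodule.finrank_le _))
    obtain ⟨e⟩ := Function.Embedding.nonempty_of_card_le hcard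
    have hne : t.Nonempty := by
      rw [Finset.nonempty_iff_ne_empty]
      rintro rfl
      simp at hw1
    obtain ⟨z₀, hz₀⟩ := hne
    have hsum : ∀ g : ι → V, (∀ i, i ∉ range e → g i = 0) → ∑ i, g i = ∑ a : t, g (e a) :=
      fun g hg => (Fintype.sum_of_injective e e.injective _ g hg fun _ => rfl).symm
    -- Unused indices are padded with weight `0` and the dummy point `z₀`.
    refine ⟨(Function.extend e (fun a => w a) 0, Function.extend e (fun a => (a : V)) fun _ => z₀),
      ⟨⟨fun i => ?_, ?_⟩, fun i _ => ?_⟩, ?_⟩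
    · by_cases hi : ∃ a, e a = i
      · obtain ⟨a, rfl⟩ := hi
        simpa [e.injective.extend_apply] using hw0 a a.2
      · simp [Function.extend_apply' _ _ _ hi]
    · rw [← hw1, ← Finset.sum_coe_sort t w]
      refine (Fintype.sum_of_injective e e.injective _ _ (fun i hi => ?_) fun a => ?_).symm
      · exact Function.extend_apply' (fun a : t => w a) (0 : ι → ℝ) i hi
      · exact (e.injective.extend_apply (fun a : t => w a) 0 a).symm
    · by_cases hi : ∃ a, e a = i
      · obtain ⟨a, rfl⟩ := hi
        simpa [e.injective.extend_apply] using htK a.2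
      · simpa [Function.extend_apply' _ _ _ hi] using htK hz₀
    · simp only
      rw [hsum]
      · simp only [e.injective.extend_apply]
        exact Finset.sum_coe_sort t fun a => w a • a
      · intro i hi
        rw [Function.extend_apply' _ _ _ hi]
        simp
  · rintro _ ⟨⟨w, z⟩, ⟨⟨hw0, hw1⟩, hz⟩, rfl⟩
    exact (convex_convexHull ℝ K).sum_mem (fun i _ => hw0 i) hw1
      fun i _ => subset_convexHull ℝ K (hz i (mem_univ i))

/-! ### Difference quotients and almost everywhere bounds on the derivative -/

section Quotient

variable {E : Type*} [NormedAddCommGroup E] [NormedSpace ℝ E] [FiniteDimensional ℝ E]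
  [MeasurableSpace E] [BorelSpace E] {m : Measure E} [m.IsAddHaarMeasure] {C : NNReal} {F : E → ℝ}

/-- Differentiation under the integral sign, dominated by `C * ‖v‖`. For each fixed `s`,
Rademacher's theorem transported by the translation gives differentiability at `z + s • v` for
almost every `z`. -/
lemma LipschitzWith.hasDerivAt_setIntegral_translate (hF : LipschitzWith C F) (y v : E) (r s : ℝ) :
    IntegrableOn (fun z => fderiv ℝ F (z + s • v) v) (Metric.ball y r) m ∧
    HasDerivAt (fun s : ℝ => ∫ z in Metric.ball y r, F (z + s • v) ∂m)
      (∫ z in Metric.ball y r, fderiv ℝ F (z + s • v) v ∂m) s := by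
  have hc : ∀ s : ℝ, Continuous fun z => F (z + s • v) := fun s =>
    hF.continuous.comp (by fun_prop)
  refine hasDerivAt_integral_of_dominated_loc_of_lip (s := univ) (bound := fun _ => C * ‖v‖)
    univ_mem (.of_forall fun s => (hc s).aestronglyMeasurable) ?_ ?_ ?_ ?_ ?_
  · exact ((hc s).locallyIntegrable.integrableOn_isCompact (isCompact_closedBall y r)).mono_set
      Metric.ball_subset_closedBall
  · exact ((measurable_fderiv_apply_const ℝ F v).comp
      (measurable_add_const (s • v))).aestronglyMeasurable
  · refine .of_forall fun z => LipschitzOnWith.of_dist_le_mul fun a _ b _ => ?_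
    rw [Real.coe_nnabs, abs_of_nonneg (by positivity)]
    refine (hF.dist_le_mul _ _).trans_eq ?_
    rw [dist_add_left, dist_eq_norm, ← sub_smul, norm_smul, dist_eq_norm]
    ring
  · have : IsFiniteMeasure (m.restrict (Metric.ball y r)) :=
      ⟨by simpa using measure_ball_lt_top⟩
    exact integrable_const _
  · refine ae_restrict_of_ae ?_
    filter_upwards [(measurePreserving_add_right m (s • v)).quasiMeasurePreserving.ae
      (hF.ae_differentiableAt (μ := m))] with z hz
    have h1 : HasDerivAt (fun s : ℝ => z + s • v) v s := by
      simpa using ((hasDerivAt_id s).smul_const v).const_add z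
    exact hz.hasFDerivAt.comp_hasDerivAt s h1

/-- If the derivative in direction `v` of a Lipschitz function is bounded by `c` almost everywhere
near a point, then so are the difference quotients there. -/
lemma LipschitzWith.sub_le_of_ae_fderiv_le (hF : LipschitzWith C F) {x v : E} {ρ c : ℝ}
    (hc : ∀ᵐ z ∂m, z ∈ Metric.ball x (2 * ρ) → fderiv ℝ F z v ≤ c) {y : E}
    (hy : y ∈ Metric.ball x ρ) {t : ℝ} (ht : 0 ≤ t) (htv : t * ‖v‖ ≤ ρ) :
    F (y + t • v) - F y ≤ c * t := by
  by_contra! hcon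
  have hcont : ∀ s : ℝ, Continuous fun z => F (z + s • v) := fun s =>
    hF.continuous.comp (by fun_prop)
  -- The almost everywhere bound may say nothing about the single segment starting at `y`. By
  -- continuity the excess `H` stays above `H y / 2` on a ball `B` around `y`, and integrating over
  -- `B` makes the bound usable.
  set H : E → ℝ := fun z => F (z + t • v) - F z - c * t
  have hH : Continuous H := ((hcont t).sub hF.continuous).sub continuous_const
  have hHy : 0 < H y := sub_pos.2 hcon
  obtain ⟨r, hr, hsub⟩ := Metric.mem_nhds_iff.1 (inter_mem
    (hH.continuousAt.eventually (lt_mem_nhds (half_lt_self hHy))) (Metric.isOpen_ball.mem_nhds hy))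
  set B := Metric.ball y r
  have hB : m B ≠ ⊤ := measure_ball_lt_top.ne
  have hBpos : 0 < m.real B := ENNReal.toReal_pos (Metric.measure_ball_pos m y hr).ne' hB
  have hint : ∀ {g : E → ℝ}, Continuous g → IntegrableOn g B m := fun hg =>
    (hg.locallyIntegrable.integrableOn_isCompact (isCompact_closedBall y r)).mono_set
      Metric.ball_subset_closedBall
  set G : ℝ → ℝ := fun s => ∫ z in B, F (z + s • v) ∂m
  have hG : ∀ s, HasDerivAt G (∫ z in B, fderiv ℝ F (z + s • v) v ∂m) s := fun s =>
    (hF.hasDerivAt_setIntegral_translate y v r s).2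
  have hbound : ∀ s ∈ interior (Icc 0 t), deriv G s ≤ c * m.real B := by
    intro s hs
    rw [interior_Icc] at hs
    rw [(hG s).deriv, mul_comm, ← smul_eq_mul, ← setIntegral_const]
    refine setIntegral_mono_on_ae (hF.hasDerivAt_setIntegral_translate y v r s).1
      (hint continuous_const) measurableSet_ball ?_
    filter_upwards [(measurePreserving_add_right m (s • v)).quasiMeasurePreserving.ae hc]
      with z hz hzB
    -- The translate stays in the ball of radius `2 * ρ`, since `z` is within `ρ` of `x` and `s *
    -- ‖v‖ ≤ ρ`.
    refine hz ?_
    have h1 : dist z x < ρ := (hsub hzB).2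
    have h2 : s * ‖v‖ ≤ t * ‖v‖ := by gcongr; exact hs.2.le
    rw [Metric.mem_ball]
    have h3 : dist (z + s • v) z = s * ‖v‖ := by
      rw [dist_eq_norm, add_sub_cancel_left, norm_smul, Real.norm_of_nonneg hs.1.le]
    linarith [dist_triangle (z + s • v) z x]
  have hle := (convex_Icc 0 t).image_sub_le_mul_sub_of_deriv_le
    (fun s _ => (hG s).continuousAt.continuousWithinAt)
    (fun s _ => (hG s).differentiableAt.differentiableWithinAt) hbound 0 ⟨le_rfl, ht⟩ t
    ⟨ht, le_rfl⟩ ht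
  have hpos : H y / 2 * m.real B ≤ ∫ z in B, H z ∂m :=
    setIntegral_ge_of_const_le_real measurableSet_ball hB (fun z hz => (hsub hz).1.le) (hint hH)
  have hsplit : ∫ z in B, H z ∂m = G t - G 0 - c * t * m.real B := by
    have e1 : ∫ z in B, H z ∂m =
        (∫ z in B, (F (z + t • v) - F z) ∂m) - ∫ _ in B, c * t ∂m :=
      integral_sub ((hint (hcont t)).sub (hint hF.continuous)) (hint continuous_const)
    rw [e1, integral_sub (hint (hcont t)) (hint hF.continuous), setIntegral_const]
    simp [G, mul_comm]
  nlinarith [mul_pos hHy hBpos]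

end Quotient

/-! ### The Clarke gradient -/

/-- Derivatives and difference quotients near `x` see only the germ of `f`, so a global Lipschitz
extension may replace it. -/
lemma LocallyLipschitz.exists_lipschitzWith_eventuallyEq {E : Type*} [PseudoMetricSpace E]
    {f : E → ℝ} (hf : LocallyLipschitz f) (x : E) :
    ∃ (C : NNReal) (F : E → ℝ), LipschitzWith C F ∧ f =ᶠ[𝓝 x] F := by
  obtain ⟨C, s, hs, hfs⟩ := hf x
  obtain ⟨F, hF, hfF⟩ := hfs.extend_real
  exact ⟨C, F, hF, mem_of_superset hs hfF⟩

section Clarke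

variable {E : Type*} [NormedAddCommGroup E] [NormedSpace ℝ E] {f g : E → ℝ} {x : E}

lemma LocallyLipschitz.exists_eventually_norm_fderiv_le (hf : LocallyLipschitz f) (x : E) :
    ∃ C : ℝ, ∀ᶠ y in 𝓝 x, ‖fderiv ℝ f y‖ ≤ C := by
  obtain ⟨C, s, hs, hfs⟩ := hf x
  exact ⟨C, (eventually_mem_nhds_iff.2 hs).mono fun y hy => norm_fderiv_le_of_lipschitzOn ℝ hy hfs⟩

lemma tendsto_translate (x v : E) :
    Tendsto (fun p : E × ℝ => p.1 + p.2 • v) (𝓝 x ×ˢ 𝓝[>] (0 : ℝ)) (𝓝 x) := by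
  have : Tendsto (fun p : E × ℝ => p.1 + p.2 • v) (𝓝 (x, 0)) (𝓝 (x + (0 : ℝ) • v)) :=
    Continuous.tendsto (by fun_prop) _
  rw [zero_smul, add_zero, nhds_prod_eq] at this
  exact this.mono_left (prod_mono le_rfl nhdsWithin_le_nhds)

lemma diffQuotient_congr (h : f =ᶠ[𝓝 x] g) (v : E) :
    (fun p : E × ℝ => (f (p.1 + p.2 • v) - f p.1) / p.2) =ᶠ[𝓝 x ×ˢ 𝓝[>] (0 : ℝ)]
      fun p => (g (p.1 + p.2 • v) - g p.1) / p.2 := by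
  filter_upwards [tendsto_fst.eventually h, (tendsto_translate x v).eventually h] with p h1 h2
  rw [h1, h2]

/-- A real `limsup` is meaningful only under boundedness; this bound supplies it for the next two
lemmas. -/
lemma LocallyLipschitz.exists_eventually_abs_diffQuotient_le (hf : LocallyLipschitz f) (x v : E) :
    ∃ M : ℝ, ∀ᶠ p : E × ℝ in 𝓝 x ×ˢ 𝓝[>] (0 : ℝ), |(f (p.1 + p.2 • v) - f p.1) / p.2| ≤ M := by
  obtain ⟨C, F, hF, hfF⟩ := hf.exists_lipschitzWith_eventuallyEq x
  refine ⟨C * ‖v‖, ?_⟩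
  filter_upwards [diffQuotient_congr hfF v, tendsto_snd.eventually self_mem_nhdsWithin]
    with p hp (hp0 : 0 < p.2)
  rw [hp, abs_div, abs_of_pos hp0, div_le_iff₀ hp0]
  have := hF.dist_le_mul (p.1 + p.2 • v) p.1
  rw [Real.dist_eq, dist_eq_norm, add_sub_cancel_left, norm_smul, Real.norm_of_nonneg hp0.le] at this
  linarith

lemma LocallyLipschitz.eventually_diffQuotient_lt (hf : LocallyLipschitz f) {v : E} {c : ℝ}
    (hc : clarkeDirDeriv f x v < c) :
    ∀ᶠ p : E × ℝ in 𝓝 x ×ˢ 𝓝[>] (0 : ℝ), (f (p.1 + p.2 • v) - f p.1) / p.2 < c := by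
  obtain ⟨M, hM⟩ := hf.exists_eventually_abs_diffQuotient_le x v
  exact eventually_lt_of_limsup_lt hc ⟨M, eventually_map.2 (hM.mono fun p hp => (abs_le.1 hp).2)⟩

lemma LocallyLipschitz.clarkeDirDeriv_le (hf : LocallyLipschitz f) {v : E} {c : ℝ}
    (hc : ∀ᶠ p : E × ℝ in 𝓝 x ×ˢ 𝓝[>] (0 : ℝ), (f (p.1 + p.2 • v) - f p.1) / p.2 ≤ c) :
    clarkeDirDeriv f x v ≤ c := by
  obtain ⟨M, hM⟩ := hf.exists_eventually_abs_diffQuotient_le x v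
  refine limsup_le_of_le ?_ hc
  have : IsBoundedUnder (· ≥ ·) (𝓝 x ×ˢ 𝓝[>] (0 : ℝ))
      fun p : E × ℝ => (f (p.1 + p.2 • v) - f p.1) / p.2 :=
    ⟨-M, eventually_map.2 (hM.mono fun p hp => (abs_le.1 hp).1)⟩
  exact this.isCoboundedUnder_le

lemma LocallyLipschitz.eventually_fderiv_le (hf : LocallyLipschitz f) {v : E} {c : ℝ}
    (hc : clarkeDirDeriv f x v < c) :
    ∀ᶠ y in 𝓝 x, DifferentiableAt ℝ f y → fderiv ℝ f y v ≤ c := by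
  -- Currying fixes the base point `y`; letting `t ↓ 0` then yields the derivative at `y`.
  filter_upwards [(hf.eventually_diffQuotient_lt hc).curry] with y hy hd
  refine le_of_tendsto (hd.hasFDerivAt.hasLineDerivAt v).tendsto_slope_zero_right
    (hy.mono fun t ht => ?_)
  rw [smul_eq_mul, mul_comm, ← div_eq_mul_inv]
  exact ht.le

lemma convex_clarkeGradient (f : E → ℝ) (x : E) : Convex ℝ (clarkeGradient f x) := by
  intro φ hφ ψ hψ a b ha hb hab v
  have h1 := mul_le_mul_of_nonneg_left (hφ v) ha
  have h2 := mul_le_mul_of_nonneg_left (hψ v) hb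
  have h3 : a * clarkeDirDeriv f x v + b * clarkeDirDeriv f x v = clarkeDirDeriv f x v := by
    rw [← add_mul, hab, one_mul]
  simp only [add_apply, smul_apply, smul_eq_mul]
  linarith

lemma LocallyLipschitz.limitingDerivs_subset (hf : LocallyLipschitz f) (N : Set E) (x : E) :
    limitingDerivs f N x ⊆ clarkeGradient f x := by
  rintro w ⟨u, hu, hdiff, hlim⟩ v
  refine le_of_forall_gt_imp_ge_of_dense fun c hc => ?_
  have hlim' : Tendsto (fun k => fderiv ℝ f (u k) v) atTop (𝓝 (w v)) :=
    (ContinuousLinearMap.apply ℝ ℝ v).continuous.continuousAt.tendsto.comp hlim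
  exact le_of_tendsto hlim' ((hu.eventually (hf.eventually_fderiv_le hc)).mono
    fun k hk => hk (hdiff k).1)

end Clarke

lemma eventually_nhds_inf_ae_iff {E : Type*} [PseudoMetricSpace E] [MeasurableSpace E]
    {m : Measure E} {x : E} {p : E → Prop} :
    (∀ᶠ y in 𝓝 x ⊓ ae m, p y) ↔ ∃ ε > 0, ∀ᵐ y ∂m, y ∈ Metric.ball x ε → p y := by
  rw [eventually_inf]
  refine ⟨?_, ?_⟩
  · rintro ⟨A, hA, B, hB, h⟩
    obtain ⟨ε, hε, hεA⟩ := Metric.mem_nhds_iff.1 hA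
    exact ⟨ε, hε, mem_of_superset hB fun y hy hyA => h y ⟨hεA hyA, hy⟩⟩
  · rintro ⟨ε, hε, h⟩
    exact ⟨_, Metric.ball_mem_nhds x hε, _, h, fun y hy => hy.2 hy.1⟩

/-! ### Essential limits of the derivative -/

section Essential

variable {E : Type*} [NormedAddCommGroup E] [NormedSpace ℝ E]
  [MeasurableSpace E] {m : Measure E} {f : E → ℝ} {x : E}

/-- The essential limits of the derivative of `f` at `x`: the cluster points of `Df` at `x` that
cannot be removed by changing `Df` on a null set. -/
def essLimitingDerivs (m : Measure E) (f : E → ℝ) (x : E) : Set (E →L[ℝ] ℝ) :=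
  {w | MapClusterPt w (𝓝 x ⊓ ae m) (fderiv ℝ f)}

lemma LocallyLipschitz.essLimitingDerivs_subset_closedBall {C : ℝ}
    (hC : ∀ᶠ y in 𝓝 x, ‖fderiv ℝ f y‖ ≤ C) :
    essLimitingDerivs m f x ⊆ Metric.closedBall 0 C := by
  intro w hw
  have h1 : ∀ᶠ y in 𝓝 x ⊓ ae m, fderiv ℝ f y ∈ Metric.closedBall 0 C :=
    (hC.filter_mono inf_le_left).mono fun y hy => by simpa using hy
  have h2 := clusterPt_iff_forall_mem_closure.1 hw _ h1
  rwa [Metric.isClosed_closedBall.closure_eq] at h2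

lemma LocallyLipschitz.isCompact_essLimitingDerivs [FiniteDimensional ℝ E] (hf : LocallyLipschitz f)
    (x : E) : IsCompact (essLimitingDerivs m f x) := by
  obtain ⟨C, hC⟩ := hf.exists_eventually_norm_fderiv_le x
  have : ProperSpace (E →L[ℝ] ℝ) := FiniteDimensional.proper ℝ _
  exact (isCompact_closedBall (0 : E →L[ℝ] ℝ) C).of_isClosed_subset isClosed_setOfPred_clusterPt
    (essLimitingDerivs_subset_closedBall hC)

variable [FiniteDimensional ℝ E] [BorelSpace E] [m.IsAddHaarMeasure]

lemma LocallyLipschitz.eventually_differentiableAt (hf : LocallyLipschitz f) (x : E) :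
    ∀ᶠ y in 𝓝 x ⊓ ae m, DifferentiableAt ℝ f y := by
  obtain ⟨C, F, hF, hfF⟩ := hf.exists_lipschitzWith_eventuallyEq x
  filter_upwards [hfF.eventually_nhds.filter_mono inf_le_left,
    Eventually.filter_mono inf_le_right (hF.ae_differentiableAt (μ := m))] with y h1 h2
  exact h2.congr_of_eventuallyEq h1

lemma LocallyLipschitz.clarkeDirDeriv_le_of_ae (hf : LocallyLipschitz f) {v : E} {c : ℝ}
    (hc : ∀ᶠ y in 𝓝 x ⊓ ae m, fderiv ℝ f y v ≤ c) : clarkeDirDeriv f x v ≤ c := by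
  obtain ⟨C, F, hF, hfF⟩ := hf.exists_lipschitzWith_eventuallyEq x
  have hc' : ∀ᶠ y in 𝓝 x ⊓ ae m, fderiv ℝ F y v ≤ c := by
    filter_upwards [hc, hfF.eventually_nhds.filter_mono inf_le_left] with y h1 h2
    rwa [← EventuallyEq.fderiv_eq h2]
  obtain ⟨ε, hε, hball⟩ := eventually_nhds_inf_ae_iff.1 hc'
  refine hf.clarkeDirDeriv_le ?_
  -- This range of `t` ensures `t * ‖v‖ ≤ ε / 2`; the `+ 1` covers `v = 0`.
  have h2 : Ioo (0 : ℝ) (ε / 2 / (‖v‖ + 1)) ∈ 𝓝[>] (0 : ℝ) :=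
    Ioo_mem_nhdsGT (by positivity)
  filter_upwards [diffQuotient_congr hfF v,
    tendsto_fst.eventually (Metric.ball_mem_nhds x (half_pos hε)),
    tendsto_snd.eventually h2] with p hp hp1 hp2
  rw [hp, div_le_iff₀ hp2.1]
  refine hF.sub_le_of_ae_fderiv_le (m := m) (ρ := ε / 2) (by rwa [mul_div_cancel₀ _ two_ne_zero])
    hp1 hp2.1.le ?_
  have h3 := (lt_div_iff₀ (by positivity)).1 hp2.2
  nlinarith [hp2.1]

lemma LocallyLipschitz.essLimitingDerivs_subset (hf : LocallyLipschitz f) {N : Set E}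
    (hN : m N = 0) : essLimitingDerivs m f x ⊆ limitingDerivs f N x := by
  intro w hw
  have hev : ∀ᶠ y in 𝓝 x ⊓ ae m, DifferentiableAt ℝ f y ∧ y ∉ N :=
    (hf.eventually_differentiableAt x).and (Eventually.filter_mono inf_le_right
      (measure_eq_zero_iff_ae_notMem.1 hN))
  -- Passing to this coarser, countably generated filter lets a sequence realise the cluster point.
  have hle : 𝓝 x ⊓ ae m ≤ 𝓝 x ⊓ 𝓟 {y | DifferentiableAt ℝ f y ∧ y ∉ N} :=
    le_inf inf_le_left (le_principal_iff.2 hev)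
  obtain ⟨u, hlim, hu⟩ := (hw.mono hle).exists_seq_tendsto
  obtain ⟨hu1, hu2⟩ := tendsto_inf.1 hu
  obtain ⟨K, hK⟩ := eventually_atTop.1 (tendsto_principal.1 hu2)
  exact ⟨fun k => u (k + K), (tendsto_add_atTop_iff_nat K).2 hu1,
    fun k => hK _ (Nat.le_add_left _ _), (tendsto_add_atTop_iff_nat K).2 hlim⟩

/-- If `Df(y) v ≥ c` held on a non-negligible set arbitrarily near `x`, compactness would give a
cluster point `w` along that set, with `w v ≥ c`. -/
lemma LocallyLipschitz.clarkeDirDeriv_le_of_essLimitingDerivs (hf : LocallyLipschitz f) {v : E}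
    {c : ℝ} (hc : ∀ w ∈ essLimitingDerivs m f x, w v < c) : clarkeDirDeriv f x v ≤ c := by
  obtain ⟨C, hC⟩ := hf.exists_eventually_norm_fderiv_le x
  have : ProperSpace (E →L[ℝ] ℝ) := FiniteDimensional.proper ℝ _
  refine hf.clarkeDirDeriv_le_of_ae (m := m) ?_
  by_contra hcon
  set A : Set E := {y | c ≤ fderiv ℝ f y v}
  have hA : ∃ᶠ y in 𝓝 x ⊓ ae m, y ∈ A :=
    (not_eventually.1 hcon).mono fun y hy => (not_le.1 hy).le
  have hne : NeBot ((𝓝 x ⊓ ae m) ⊓ 𝓟 A) := frequently_mem_iff_neBot.1 hA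
  obtain ⟨w, -, hw⟩ := (isCompact_closedBall (0 : E →L[ℝ] ℝ) C).exists_mapClusterPt
    (f := (𝓝 x ⊓ ae m) ⊓ 𝓟 A) (u := fderiv ℝ f) <| tendsto_principal.2 <|
      (hC.filter_mono (inf_le_left.trans inf_le_left)).mono fun y hy => by simpa using hy
  refine (hc w (hw.mono inf_le_left)).not_ge ?_
  have hcl : IsClosed {w : E →L[ℝ] ℝ | c ≤ w v} :=
    isClosed_le continuous_const (ContinuousLinearMap.apply ℝ ℝ v).continuous
  have h2 := clusterPt_iff_forall_mem_closure.1 hw {w | c ≤ w v}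
    (mem_inf_of_right (mem_principal_self A))
  rwa [hcl.closure_eq] at h2

end Essential

/-! ### The Clarke gradient as a convex hull -/

section Representation

variable {E : Type*} [NormedAddCommGroup E] [InnerProductSpace ℝ E] [FiniteDimensional ℝ E]
  [MeasurableSpace E] [BorelSpace E] {m : Measure E} [m.IsAddHaarMeasure] {f : E → ℝ}

lemma LocallyLipschitz.clarkeGradient_subset (hf : LocallyLipschitz f) (x : E) :
    clarkeGradient f x ⊆ convexHull ℝ (essLimitingDerivs m f x) := by
  intro φ hφ
  by_contra hcon
  obtain ⟨ℓ, u, hlt, hu⟩ := geometric_hahn_banach_closed_point (convex_convexHull ℝ _)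
    (hf.isCompact_essLimitingDerivs (m := m) x).isCompact_convexHull.isClosed hcon
  have : CompleteSpace E := FiniteDimensional.complete ℝ E
  -- By the Riesz isomorphism the separating functional on the dual is evaluation at some `v`, so
  -- separation reads `f°(x; v) ≤ u < φ v`.
  let D := InnerProductSpace.toDual ℝ E
  let L : E →ₗ[ℝ] ℝ :=
    { toFun := fun z => ℓ (D z)
      map_add' := fun a b => by simp
      map_smul' := fun a b => by simp }
  let v := D.symm (LinearMap.toContinuousLinearMap L)
  have hℓ : ∀ w, ℓ w = w v := by
    intro w
    obtain ⟨z, rfl⟩ := D.surjective w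
    have h1 : inner ℝ v z = ℓ (D z) := InnerProductSpace.toDual_symm_apply
    rw [← h1, InnerProductSpace.toDual_apply_apply, real_inner_comm]
  have h2 := hf.clarkeDirDeriv_le_of_essLimitingDerivs (m := m) (v := v) (c := u)
    fun w hw => hℓ w ▸ hlt w (subset_convexHull ℝ _ hw)
  linarith [hφ v, hℓ φ]

theorem LocallyLipschitz.clarkeGradient_eq_convexHull_ess (hf : LocallyLipschitz f) (x : E) :
    clarkeGradient f x = convexHull ℝ (essLimitingDerivs m f x) :=
  (hf.clarkeGradient_subset x).antisymm <| convexHull_min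
    ((hf.essLimitingDerivs_subset measure_empty).trans (hf.limitingDerivs_subset ∅ x))
    (convex_clarkeGradient f x)

theorem LocallyLipschitz.clarkeGradient_eq_convexHull (hf : LocallyLipschitz f) {N : Set E}
    (hN : m N = 0) (x : E) : clarkeGradient f x = convexHull ℝ (limitingDerivs f N x) :=
  ((hf.clarkeGradient_subset x).trans (convexHull_mono (hf.essLimitingDerivs_subset hN))).antisymm
    (convexHull_min (hf.limitingDerivs_subset N x) (convex_clarkeGradient f x))

end Representation

/-! ### Density measures -/

section Density

open FinAddMeasure

variable {n : ℕ} {x : EuclideanSpace ℝ (Fin n)} {μ ν : FinAddMeasure (EuclideanSpace ℝ (Fin n))}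
  {f : EuclideanSpace ℝ (Fin n) → ℝ}

/-- Outside a small ball there is no mass, and inside it `Sᶜ` is Lebesgue-null. Thus properties
valid along `𝓝 x ⊓ ae` hold on sets of full mass. -/
lemma IsDensityMeasure.compl_eq_zero (hμ : IsDensityMeasure x μ)
    {S : Set (EuclideanSpace ℝ (Fin n))} (hS : MeasurableSet S) (h : S ∈ 𝓝 x ⊓ ae volume) :
    μ Sᶜ = 0 := by
  have hpos : IsPos μ := hμ.nonneg
  obtain ⟨ε, hε, hae⟩ := eventually_nhds_inf_ae_iff.1 h
  have hB : MeasurableSet (Metric.ball x ε) := measurableSet_ball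
  have h1 : μ (Metric.ball x ε)ᶜ = 0 := by
    have := add_compl (μ := μ) hB
    rw [hμ.ball ε hε, hμ.total] at this
    linarith
  have h2 : μ (Metric.ball x ε \ S) = 0 := by
    refine hμ.null _ (hB.diff hS) (measure_mono_null ?_ hae)
    exact fun y hy hcon => hy.2 (hcon hy.1)
  refine le_antisymm ?_ (hpos _ hS.compl)
  have h3 := hpos.mono hS.compl ((hB.diff hS).union hB.compl) fun y hy => by
    by_cases hyB : y ∈ Metric.ball x ε
    · exact Or.inl ⟨hyB, hy⟩
    · exact Or.inr hyB
  linarith [hpos.union_le (hB.diff hS) hB.compl]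

lemma IsDensityMeasure.combo (hμ : IsDensityMeasure x μ) (hν : IsDensityMeasure x ν) {a b : ℝ}
    (ha : 0 ≤ a) (hb : 0 ≤ b) (hab : a + b = 1) : IsDensityMeasure x (combo a b μ ν) where
  nonneg := IsPos.combo hμ.nonneg hν.nonneg ha hb
  null A hA h0 := by simp [combo_apply, hμ.null A hA h0, hν.null A hA h0]
  total := by simp [combo_apply, hμ.total, hν.total, hab]
  ball δ hδ := by simp [combo_apply, hμ.ball δ hδ, hν.ball δ hδ, hab]

lemma isDensityMeasure_ofUltrafilter {U : Ultrafilter (EuclideanSpace ℝ (Fin n))}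
    (hU : (U : Filter (EuclideanSpace ℝ (Fin n))) ≤ 𝓝 x ⊓ ae volume) :
    IsDensityMeasure x (ofUltrafilter U) where
  nonneg := isPos_ofUltrafilter U
  null _ _ h0 := ofUltrafilter_of_notMem <| Ultrafilter.compl_mem_iff_notMem.1 <|
    hU (mem_inf_of_right (compl_mem_ae_iff.2 h0))
  total := ofUltrafilter_of_mem univ_mem
  ball _ hδ := ofUltrafilter_of_mem (hU (mem_inf_of_left (Metric.ball_mem_nhds x hδ)))

lemma measurableSet_norm_fderiv_le (C : ℝ) : MeasurableSet {y | ‖fderiv ℝ f y‖ ≤ C} :=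
  measurableSet_le (measurable_fderiv ℝ f).norm measurable_const

lemma IsDensityMeasure.hasVectorIntegral_unique (hμ : IsDensityMeasure x μ)
    {F : EuclideanSpace ℝ (Fin n) → (EuclideanSpace ℝ (Fin n) →L[ℝ] ℝ)}
    {w w' : EuclideanSpace ℝ (Fin n) →L[ℝ] ℝ}
    (h : HasVectorIntegral μ F w) (h' : HasVectorIntegral μ F w') : w = w' :=
  ContinuousLinearMap.ext fun v => IsPos.hasIntegral_unique hμ.nonneg hμ.total (h v) (h' v)

lemma IsDensityMeasure.exists_hasVectorIntegral (hμ : IsDensityMeasure x μ)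
    (hf : LocallyLipschitz f) : ∃ w, HasVectorIntegral μ (fderiv ℝ f) w := by
  have hpos : IsPos μ := hμ.nonneg
  obtain ⟨C, hC⟩ := hf.exists_eventually_norm_fderiv_le x
  have hS := measurableSet_norm_fderiv_le (f := f) C
  have hS0 := hμ.compl_eq_zero hS (mem_inf_of_left hC)
  choose a ha using fun v => hpos.exists_hasIntegral hμ.total
    (measurable_fderiv_apply_const ℝ f v) hS hS0 (M := C * ‖v‖)
    fun y hy => (fderiv ℝ f y).le_of_opNorm_le hy v
  -- Uniqueness of the integral makes the chosen values linear in the direction.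
  have hadd : ∀ u v, a (u + v) = a u + a v := fun u v =>
    hpos.hasIntegral_unique hμ.total (ha (u + v)) <| by
      convert hpos.hasIntegral_add (ha u) (ha v) using 1
      ext y
      simp
  have hsmul : ∀ (c : ℝ) v, a (c • v) = c * a v := fun c v =>
    hpos.hasIntegral_unique hμ.total (ha (c • v)) <| by
      convert hpos.hasIntegral_smul c (ha v) using 1
      ext y
      simp
  exact ⟨LinearMap.toContinuousLinearMap ⟨⟨a, hadd⟩, hsmul⟩, ha⟩

lemma LocallyLipschitz.densityIntegrals_subset (hf : LocallyLipschitz f) :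
    densityIntegrals f x ⊆ clarkeGradient f x := by
  rintro w ⟨μ, hμ, hw⟩ v
  refine le_of_forall_gt_imp_ge_of_dense fun c hc => ?_
  have hS : MeasurableSet {y | fderiv ℝ f y v ≤ c} :=
    measurableSet_le (measurable_fderiv_apply_const ℝ f v) measurable_const
  refine IsPos.le_of_hasIntegral hμ.nonneg hμ.total (hw v) hS (hμ.compl_eq_zero hS ?_)
    fun y hy => hy
  filter_upwards [(hf.eventually_fderiv_le hc).filter_mono inf_le_left,
    hf.eventually_differentiableAt x] with y h1 h2
  exact h1 h2

/-- A cluster point is the limit along some ultrafilter finer than `𝓝 x ⊓ ae`, hence the integral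
for its two-valued measure. -/
lemma essLimitingDerivs_subset_densityIntegrals :
    essLimitingDerivs volume f x ⊆ densityIntegrals f x := by
  intro w hw
  obtain ⟨U, hU, hlim⟩ := mapClusterPt_iff_ultrafilter.1 hw
  refine ⟨ofUltrafilter U, isDensityMeasure_ofUltrafilter hU, fun v => ?_⟩
  exact hasIntegral_ofUltrafilter (measurable_fderiv_apply_const ℝ f v)
    ((ContinuousLinearMap.apply ℝ ℝ v).continuous.continuousAt.tendsto.comp hlim)

lemma LocallyLipschitz.convex_densityIntegrals (hf : LocallyLipschitz f) :
    Convex ℝ (densityIntegrals f x) := by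
  rintro w ⟨μ, hμ, hw⟩ w' ⟨ν, hν, hw'⟩ a b ha hb hab
  obtain ⟨C, hC⟩ := hf.exists_eventually_norm_fderiv_le x
  have hS := measurableSet_norm_fderiv_le (f := f) C
  refine ⟨FinAddMeasure.combo a b μ ν, hμ.combo hν ha hb hab, fun v => ?_⟩
  exact IsPos.hasIntegral_combo hμ.nonneg hν.nonneg hμ.total hν.total ha hb hab
    (measurable_fderiv_apply_const ℝ f v) hS (hμ.compl_eq_zero hS (mem_inf_of_left hC))
    (hν.compl_eq_zero hS (mem_inf_of_left hC)) (M := C * ‖v‖)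
    (fun y hy => (fderiv ℝ f y).le_of_opNorm_le hy v) (hw v) (hw' v)

theorem LocallyLipschitz.clarkeGradient_eq_densityIntegrals (hf : LocallyLipschitz f) :
    clarkeGradient f x = densityIntegrals f x := by
  refine subset_antisymm ?_ hf.densityIntegrals_subset
  rw [hf.clarkeGradient_eq_convexHull_ess (m := volume) x]
  exact convexHull_min essLimitingDerivs_subset_densityIntegrals hf.convex_densityIntegrals

end Density

end

theorem theorem7p2 (n : ℕ) (f : EuclideanSpace ℝ (Fin n) → ℝ) (hf : LocallyLipschitz f)
    (N : Set (EuclideanSpace ℝ (Fin n))) (hN : volume N = 0)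
    (x : EuclideanSpace ℝ (Fin n)) :
    clarkeGradient f x = convexHull ℝ (limitingDerivs f N x) ∧
    (∀ μ : FinAddMeasure (EuclideanSpace ℝ (Fin n)), IsDensityMeasure x μ →
      ∃! w : EuclideanSpace ℝ (Fin n) →L[ℝ] ℝ,
        FinAddMeasure.HasVectorIntegral μ (fderiv ℝ f) w) ∧
    clarkeGradient f x = densityIntegrals f x := by
  refine ⟨hf.clarkeGradient_eq_convexHull hN x, fun μ hμ => ?_,
    hf.clarkeGradient_eq_densityIntegrals⟩
  obtain ⟨w, hw⟩ := hμ.exists_hasVectorIntegral hf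
  exact ⟨w, hw, fun w' hw' => hμ.hasVectorIntegral_unique hw' hw⟩
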